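/- **Model.** A network consists of $K\ge 1$ source–destination (V2V) pairs with positions $\mathbf x_{S,i},\mathbf x_{D,i}\in\mathbb R^2$ and one roadside unit (RSU) at $\mathbf x_R\in\mathbb R^2$, where for each $i$ the points $\mathbf x_{S,i},\mathbf x_{D,i},\mathbf x_R$ are pairwise distinct; powers $P_s,P_r,N_0>0$; real path loss exponents $\alpha_1,\alpha_2$; RTS, CTS and idle-slot durations $\tau_R,\tau_C,\delta>0$; a transmission duration $\tau_d>\tau_1:=\tau_R+\tau_C$; and an RTS probability $p_0\in(0,1)$. Put $\tau_{d,1}=\tau_d-\tau_1$. In each contention slot every source sends an RTS independently with probability $p_0$; a slot lasts $\delta$ if nobody sends, $\tau_R$ if several sources send, and $\tau_R+\tau_C$ if exactly one sends, which then wins the contention. In each round (successful contention) the SNRs $\gamma_i,\gamma_{1,i},\gamma_{2,i}$ of all pairs are independent exponential variables with means $P_s\|\mathbf x_{S,i}-\mathbf x_{D,i}\|^{-\alpha_1}/N_0$, $P_s\|\mathbf x_{S,i}-\mathbf x_R\|^{-\alpha_2}/N_0$, $P_r\|\mathbf x_R-\mathbf x_{D,i}\|^{-\alpha_2}/N_0$;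 rounds are i.i.d. After the $k$th successful contention the winner $w(k)$ and $\gamma=\gamma_{w(k)}(k)$ are observed, and a strategy, on the basis of all observations so far, either stops (data $\tau_d R_d$, $R_d=\log_2(1+\gamma)$), or re-contends, or probes the RSU at the cost of time $\tau_1$, observes $\gamma_{1},\gamma_2$ of the winner, and then either stops (data $\tau_{d,1}\max\{R_d,R_r\}$, $R_r=\tfrac12\log_2\bigl(1+\gamma+\tfrac{\gamma_1\gamma_2}{\gamma_1+\gamma_2+1}\bigr)$) or re-contends. With $Y$ the transmitted data and $T$ the total time (all contention times, $\tau_1$ for each probing in an earlier round, and $\tau_d$), the maximal throughput is $\lambda^*=\sup \mathbb E[Y]/\mathbb E[T]$ over all strategies that stop almost surely and for which $Y,T$ have finite mean. **Closed-form decision function.** For $\gamma\ge0$ let $\Omega=\max\{4^{\lambda}-1,\gamma^2+2\gamma\}$, $c_i=N_0\bigl(P_s^{-1}\|\mathbf x_{S,i}-\mathbf x_R\|^{\alpha_2}+P_r^{-1}\|\mathbf x_R-\mathbf x_{D,i}\|^{\alpha_2}\bigr)$, $F_{r,i}(x)=1-e^{-c_ix}$, $\mathrm E_1(x)=\int_x^\infty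 t^{-1}e^{-t}\,dt$, $R_d=\log_2(1+\gamma)$, and $$\hat W_i(\gamma,\lambda)=\frac{\tau_{d,1}}{2\ln2}\Bigl(e^{-c_i(\Omega-\gamma)}\ln(\Omega+1)+e^{c_i(1+\gamma)}\mathrm E_1\bigl(c_i(\Omega+1)\bigr)\Bigr)+\tau_{d,1}\Bigl(\mathbb I[R_d>\lambda](R_d-\lambda)F_{r,i}(\gamma^2+\gamma)+\lambda F_{r,i}(\Omega-\gamma)\Bigr)-\lambda\tau_d .$$ **Strategy.** For a price $\lambda^*$ the two-stage strategy $\hat{\mathcal H}_s^*$ acts as follows after a successful contention won by pair $i$ with V2V SNR $\gamma$: it stops and transmits over the V2V link if $\tau_dR_d-\lambda^*\tau_d\ge\max\{\hat W_i(\gamma,\lambda^*),0\}$; it re-contends if $\tau_dR_d-\lambda^*\tau_d<0$ and $\hat W_i(\gamma,\lambda^*)<0$; otherwise it probes the RSU, after which it stops iff $\max\{R_d,R_r\}\ge\lambda^*$. Here $\lambda^*$ is the maximal throughput defined above, or, alternatively, any solution $\lambda$ of the optimality equation with the closed-form functions, $$\frac1K\sum_{i=1}^K\mathbb E\bigl[\max\{\tau_d\log_2(1+\gamma_i)-\lambda\tau_d,\,0,\,\hat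 W_i(\gamma_i,\lambda)\}\bigr]=\lambda\tau_o,$$ $$\tau_o=\tau_R+\tau_C+\frac{(1-p_0)^K\delta}{Kp_0(1-p_0)^{K-1}}+\frac{(1-(1-p_0)^K-Kp_0(1-p_0)^{K-1})\tau_R}{Kp_0(1-p_0)^{K-1}};$$ the result holds for both. Let $\mathcal K^*=\{i:\hat W_i(2^{\lambda^*}-1,\lambda^*)>0\}$. **Claim.** Let $i\notin\mathcal K^*$. Then: 1. $\hat W_i(\gamma,\lambda^*)\le\max\{(\log_2(1+\gamma)-\lambda^*)\tau_d,\,0\}$ for all $\gamma\ge0$. 2. Whenever pair $i$ wins a contention (in any round, after any history) with V2V SNR $\gamma\ge0$, the strategy $\hat{\mathcal H}_s^*$ never probes the RSU: it stops and transmits over the V2V link if $\gamma\ge2^{\lambda^*}-1$, and re-contends otherwise. 3. In terms of thresholds: if $\zeta\ge0$ satisfies $\hat W_i(\zeta,\lambda^*)=0$ and $\eta\ge0$ satisfies $\hat W_i(\eta,\lambda^*)=\tau_d(\log_2(1+\eta)-\lambda^*)$, then $\eta\le2^{\lambda^*}-1\le\zeta$. Hence in the threshold structure "stop if $\gamma\ge\eta$,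 re-contend if $\gamma<\zeta$, probe the RSU otherwise" no SNR $\gamma\ge0$ leads to probing, and the single-stage rule of item 2 always takes a decision that this structure allows. -/

import Mathlib

open MeasureTheory ProbabilityTheory

/-- The exponential integral `E₁(x) = ∫_x^∞ e^{-t} / t dt` (for `x > 0`). -/
noncomputable def expIntegralE1 (x : ℝ) : ℝ :=
  ∫ t in Set.Ioi x, Real.exp (-t) / t

/-- A snapshot of the network: `K` vehicle-to-vehicle (V2V) pairs and one roadside unit (RSU), with
positions in the plane, transmission powers, noise power, path loss exponents, durations, and the
probability of sending an RTS packet in a slot. -/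
structure Network where
  K : ℕ
  K_pos : 0 < K
  /-- positions of the sources -/
  xS : Fin K → EuclideanSpace ℝ (Fin 2)
  /-- positions of the destinations -/
  xD : Fin K → EuclideanSpace ℝ (Fin 2)
  /-- position of the RSU -/
  xR : EuclideanSpace ℝ (Fin 2)
  xS_ne_xD : ∀ i, xS i ≠ xD i
  xS_ne_xR : ∀ i, xS i ≠ xR
  xR_ne_xD : ∀ i, xR ≠ xD i
  Ps : ℝ
  Ps_pos : 0 < Ps
  Pr : ℝ
  Pr_pos : 0 < Pr
  N0 : ℝ
  N0_pos : 0 < N0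
  α₁ : ℝ
  α₂ : ℝ
  /-- duration of an RTS packet -/
  τR : ℝ
  τR_pos : 0 < τR
  /-- duration of a CTS packet -/
  τC : ℝ
  τC_pos : 0 < τC
  /-- duration of an idle slot -/
  δ : ℝ
  δ_pos : 0 < δ
  /-- maximal transmission duration; probing the RSU leaves a positive transmission time -/
  τd : ℝ
  probe_lt_τd : τR + τC < τd
  p₀ : ℝ
  p₀_pos : 0 < p₀
  p₀_lt_one : p₀ < 1

namespace Network

/-! ### Durations and mean signal-to-noise ratios -/

/-- Duration `τ₁` of an RSU probing. -/
noncomputable def τ₁ (N : Network) : ℝ := N.τR + N.τC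

/-- Duration `τ_{d,1}` of a data transmission after an RSU probing. -/
noncomputable def τd₁ (N : Network) : ℝ := N.τd - N.τ₁

/-- Probability `K p₀ (1 - p₀)^(K - 1)` that a contention slot is successful. -/
noncomputable def successProb (N : Network) : ℝ :=
  N.K * N.p₀ * (1 - N.p₀) ^ (N.K - 1)

/-- Mean duration `τ_o` of a channel contention. -/
noncomputable def τo (N : Network) : ℝ :=
  N.τR + N.τC + (1 - N.p₀) ^ N.K * N.δ / N.successProb
    + (1 - (1 - N.p₀) ^ N.K - N.successProb) * N.τR / N.successProb

/-- Mean SNR of the V2V link of pair `i`. -/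
noncomputable def meanV2V (N : Network) (i : Fin N.K) : ℝ :=
  N.Ps * ‖N.xS i - N.xD i‖ ^ (-N.α₁) / N.N0

/-- Mean SNR of the link from source `i` to the RSU. -/
noncomputable def meanV2R (N : Network) (i : Fin N.K) : ℝ :=
  N.Ps * ‖N.xS i - N.xR‖ ^ (-N.α₂) / N.N0

/-- Mean SNR of the link from the RSU to destination `i`. -/
noncomputable def meanR2V (N : Network) (i : Fin N.K) : ℝ :=
  N.Pr * ‖N.xR - N.xD i‖ ^ (-N.α₂) / N.N0

theorem meanV2V_pos (N : Network) (i : Fin N.K) : 0 < N.meanV2V i :=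
  div_pos (mul_pos N.Ps_pos (Real.rpow_pos_of_pos
    (norm_pos_iff.2 (sub_ne_zero.2 (N.xS_ne_xD i))) _)) N.N0_pos

theorem meanV2R_pos (N : Network) (i : Fin N.K) : 0 < N.meanV2R i :=
  div_pos (mul_pos N.Ps_pos (Real.rpow_pos_of_pos
    (norm_pos_iff.2 (sub_ne_zero.2 (N.xS_ne_xR i))) _)) N.N0_pos

theorem meanR2V_pos (N : Network) (i : Fin N.K) : 0 < N.meanR2V i :=
  div_pos (mul_pos N.Pr_pos (Real.rpow_pos_of_pos
    (norm_pos_iff.2 (sub_ne_zero.2 (N.xR_ne_xD i))) _)) N.N0_pos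

/-! ### The random experiment -/

/-- The randomness of one round (one successful channel contention): which sources send an RTS in
each slot of the contention, and, for every pair, the SNRs `γ` (V2V), `γ₁` (source to RSU) and
`γ₂` (RSU to destination). -/
abbrev RoundSample (N : Network) : Type :=
  (ℕ → Fin N.K → Bool) × (Fin N.K → ℝ) × (Fin N.K → ℝ) × (Fin N.K → ℝ)

/-- The law of one round: in every slot each source sends an RTS with probability `p₀`, the SNRs
are exponential with their respective means, and all these variables are independent. -/
noncomputable def roundLaw (N : Network) : Measure N.RoundSample :=
  (Measure.infinitePi fun _ : ℕ => Measure.infinitePi fun _ : Fin N.K =>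
      bernoulliMeasure true false (⟨N.p₀, N.p₀_pos.le, N.p₀_lt_one.le⟩ : unitInterval)).prod
    ((Measure.pi fun i => expMeasure (N.meanV2V i)⁻¹).prod
      ((Measure.pi fun i => expMeasure (N.meanV2R i)⁻¹).prod
        (Measure.pi fun i => expMeasure (N.meanR2V i)⁻¹)))

instance (N : Network) : IsProbabilityMeasure N.roundLaw := by
  haveI h0 : ∀ i, IsProbabilityMeasure (expMeasure (N.meanV2V i)⁻¹) := fun i =>
    isProbabilityMeasure_expMeasure (inv_pos.2 (N.meanV2V_pos i))
  haveI h1 : ∀ i, IsProbabilityMeasure (expMeasure (N.meanV2R i)⁻¹) := fun i =>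
    isProbabilityMeasure_expMeasure (inv_pos.2 (N.meanV2R_pos i))
  haveI h2 : ∀ i, IsProbabilityMeasure (expMeasure (N.meanR2V i)⁻¹) := fun i =>
    isProbabilityMeasure_expMeasure (inv_pos.2 (N.meanR2V_pos i))
  unfold roundLaw
  infer_instance

/-- The sample space of the whole process; rounds are numbered from `0`. -/
abbrev Sample (N : Network) : Type := ℕ → N.RoundSample

/-- The rounds are independent and identically distributed. -/
noncomputable def law (N : Network) : Measure N.Sample :=
  Measure.infinitePi fun _ : ℕ => N.roundLaw

/-- The sources that send an RTS in slot `j` of a round. -/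
def senders (N : Network) (r : N.RoundSample) (j : ℕ) : Finset (Fin N.K) :=
  Finset.univ.filter fun i => r.1 j i = true

/-- The first slot of a round in which exactly one source sends an RTS. -/
noncomputable def winSlot (N : Network) (r : N.RoundSample) : ℕ :=
  sInf {j | (N.senders r j).card = 1}

open Classical in
/-- The winner of the contention (with a default value on the null event that no slot is
successful). -/
noncomputable def winner (N : Network) (r : N.RoundSample) : Fin N.K :=
  if h : (N.senders r (N.winSlot r)).Nonempty then h.choose else ⟨0, N.K_pos⟩

/-- Contention time: an idle slot lasts `δ`, a collision `τ_R`, the successful slot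
`τ_R + τ_C`. -/
noncomputable def contentionTime (N : Network) (r : N.RoundSample) : ℝ :=
  (∑ j ∈ Finset.range (N.winSlot r), if N.senders r j = ∅ then N.δ else N.τR) + (N.τR + N.τC)

/-! ### Strategies -/

/-- What is observed after a successful contention: winner, contention time, V2V SNR. -/
abbrev FirstObs (N : Network) : Type := Fin N.K × ℝ × ℝ

/-- The first observation in a round. -/
noncomputable def firstObs (N : Network) (r : N.RoundSample) : N.FirstObs :=
  (N.winner r, N.contentionTime r, r.2.1 (N.winner r))

/-- The second observation in a round: the SNRs `γ₁`, `γ₂` of the winner. -/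
noncomputable def secondObs (N : Network) (r : N.RoundSample) : ℝ × ℝ :=
  (r.2.2.1 (N.winner r), r.2.2.2 (N.winner r))

/-- What is known about a finished round: the first observation, whether the RSU was probed, and
the second observation if so (`(0, 0)` otherwise). -/
abbrev Record (N : Network) : Type := N.FirstObs × Bool × (ℝ × ℝ)

end Network

/-- The decisions after a successful contention: stop and transmit over the V2V link (`halt`),
re-contend, or probe the RSU. -/
inductive Decision
  | halt
  | recontend
  | probe

namespace Network

/-- A channel access strategy. In round `k`, given the records of rounds `0, …, k - 1`, `first`
decides upon the first observation; if the RSU is probed, `second` tells whether to stop upon the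
second observation (`true`) or to re-contend (`false`). -/
structure Strategy (N : Network) where
  first : (k : ℕ) → (Fin k → N.Record) → N.FirstObs → Decision
  second : (k : ℕ) → (Fin k → N.Record) → N.FirstObs → ℝ × ℝ → Bool

/-- Rate `R_d = log₂ (1 + γ)` of the V2V link. -/
noncomputable def rateV2V (γ : ℝ) : ℝ := Real.logb 2 (1 + γ)

/-- Rate `R_r = (1/2) log₂ (1 + γ + γ₁ γ₂ / (γ₁ + γ₂ + 1))` of the RSU-aided transmission. -/
noncomputable def rateRSU (γ : ℝ) (g : ℝ × ℝ) : ℝ :=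
  1 / 2 * Real.logb 2 (1 + (γ + g.1 * g.2 / (g.1 + g.2 + 1)))

namespace Strategy

variable {N : Network}

open Classical in
/-- The record of round `k` under strategy `s`. -/
noncomputable def record (s : N.Strategy) (k : ℕ) (h : Fin k → N.Record) (r : N.RoundSample) :
    N.Record :=
  if s.first k h (N.firstObs r) = Decision.probe then (N.firstObs r, true, N.secondObs r)
  else (N.firstObs r, false, (0, 0))

/-- The records of rounds `0, …, k - 1` if the process has not been stopped before round `k`. -/
noncomputable def history (s : N.Strategy) (ω : N.Sample) : (k : ℕ) → Fin k → N.Record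
  | 0 => Fin.elim0
  | k + 1 => Fin.snoc (s.history ω k) (s.record k (s.history ω k) (ω k))

/-- The decision upon the first observation in round `k`. -/
noncomputable def decision (s : N.Strategy) (ω : N.Sample) (k : ℕ) : Decision :=
  s.first k (s.history ω k) (N.firstObs (ω k))

/-- The strategy stops in round `k`. -/
def StopsAt (s : N.Strategy) (ω : N.Sample) (k : ℕ) : Prop :=
  s.decision ω k = Decision.halt ∨
    (s.decision ω k = Decision.probe ∧
      s.second k (s.history ω k) (N.firstObs (ω k)) (N.secondObs (ω k)) = true)

/-- The round in which the process stops. -/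
noncomputable def stopRound (s : N.Strategy) (ω : N.Sample) : ℕ := sInf {k | s.StopsAt ω k}

open Classical in
/-- The amount of transmitted data `Y`. -/
noncomputable def reward (s : N.Strategy) (ω : N.Sample) : ℝ :=
  let r := ω (s.stopRound ω)
  let γ := (N.firstObs r).2.2
  if s.decision ω (s.stopRound ω) = Decision.halt then N.τd * rateV2V γ
  else N.τd₁ * max (rateV2V γ) (rateRSU γ (N.secondObs r))

open Classical in
/-- The time `T` spent: all contentions, earlier RSU probings, and `τ_d` (which comprises
the RSU probing of the last round, if any, and the data transmission). -/
noncomputable def time (s : N.Strategy) (ω : N.Sample) : ℝ :=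
  (∑ l ∈ Finset.range (s.stopRound ω + 1), N.contentionTime (ω l))
    + (∑ l ∈ Finset.range (s.stopRound ω),
        if s.decision ω l = Decision.probe then N.τ₁ else 0)
    + N.τd

/-- Feasible strategies: the decisions depend measurably on the observations, the process stops
almost surely, and the reward and the time have finite means. -/
structure Feasible (s : N.Strategy) : Prop where
  measurable_first : ∀ k d,
    MeasurableSet {p : (Fin k → N.Record) × N.FirstObs | s.first k p.1 p.2 = d}
  measurable_second : ∀ k,
    MeasurableSet {p : (Fin k → N.Record) × N.FirstObs × (ℝ × ℝ) |
      s.second k p.1 p.2.1 p.2.2 = true}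
  stops : ∀ᵐ ω ∂N.law, ∃ k, s.StopsAt ω k
  integrable_reward : Integrable s.reward N.law
  integrable_time : Integrable s.time N.law

/-- Average network throughput `E[Y] / E[T]`. -/
noncomputable def throughput (s : N.Strategy) : ℝ :=
  (∫ ω, s.reward ω ∂N.law) / (∫ ω, s.time ω ∂N.law)

end Strategy

/-- `lam` is the maximal average network throughput: the supremum of `E[Y] / E[T]` over all
feasible strategies. -/
def IsMaxThroughput (N : Network) (lam : ℝ) : Prop :=
  IsLUB {x | ∃ s : N.Strategy, s.Feasible ∧ x = s.throughput} lam

/-! ### The closed-form decision function and the strategy built from it -/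

/-- The rate `c_i` of the exponential variable `min {γ₁, γ₂}`. -/
noncomputable def relayRate (N : Network) (i : Fin N.K) : ℝ :=
  N.N0 * (N.Ps⁻¹ * ‖N.xS i - N.xR‖ ^ N.α₂ + N.Pr⁻¹ * ‖N.xR - N.xD i‖ ^ N.α₂)

/-- `F_{r,i}(x) = 1 - exp (- c_i x)`. -/
noncomputable def relayCDF (N : Network) (i : Fin N.K) (x : ℝ) : ℝ :=
  1 - Real.exp (-(N.relayRate i * x))

open Classical in
/-- The closed-form function `Ŵ_i(γ, λ)`. -/
noncomputable def What (N : Network) (i : Fin N.K) (γ lam : ℝ) : ℝ :=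
  let Ω := max ((4 : ℝ) ^ lam - 1) (γ ^ 2 + 2 * γ)
  let c := N.relayRate i
  N.τd₁ / (2 * Real.log 2) *
      (Real.exp (-(c * (Ω - γ))) * Real.log (Ω + 1)
        + Real.exp (c * (1 + γ)) * expIntegralE1 (c * (Ω + 1)))
    + N.τd₁ * ((if rateV2V γ > lam then
          (rateV2V γ - lam) * N.relayCDF i (γ ^ 2 + γ) else 0)
        + lam * N.relayCDF i (Ω - γ))
    - lam * N.τd

/-- `lam` solves the optimality equation
`E[max {τ_d R_d - λ τ_d, 0, Ŵ_w(γ_w, λ)}] = λ τ_o`, where the winner `w` is uniform and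
`γ_i` is exponential. -/
def SolvesClosedFormEquation (N : Network) (lam : ℝ) : Prop :=
  (1 / (N.K : ℝ)) * ∑ i : Fin N.K,
      ∫ x, max (max (N.τd * rateV2V x - lam * N.τd) 0) (N.What i x lam)
        ∂(expMeasure (N.meanV2V i)⁻¹)
    = lam * N.τo

open Classical in
/-- The strategy `Ĥ_s^*` with price `lam` and decision functions `Ŵ_i`. -/
noncomputable def hatStrategy (N : Network) (lam : ℝ) : N.Strategy where
  first := fun _ _ o =>
    let reward := N.τd * rateV2V o.2.2 - lam * N.τd
    if reward ≥ max (N.What o.1 o.2.2 lam) 0 then Decision.halt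
    else if reward < 0 ∧ N.What o.1 o.2.2 lam < 0 then Decision.recontend
    else Decision.probe
  second := fun _ _ o g => decide (max (rateV2V o.2.2) (rateRSU o.2.2 g) ≥ lam)

/-- The set `𝒦*` of pairs that can benefit from the RSU. -/
def KStar (N : Network) (lam : ℝ) : Set (Fin N.K) :=
  {i | 0 < N.What i ((2 : ℝ) ^ lam - 1) lam}

/-- `ζ` is the threshold for probing against re-contending. -/
def IsZeta (N : Network) (i : Fin N.K) (lam ζ : ℝ) : Prop :=
  0 ≤ ζ ∧ N.What i ζ lam = 0

/-- `η` is the threshold for stopping against probing. -/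
def IsEta (N : Network) (i : Fin N.K) (lam η : ℝ) : Prop :=
  0 ≤ η ∧ N.What i η lam = N.τd * (rateV2V η - lam)

/-- First-stage decisions that the thresholds `ζ`, `η` allow at V2V SNR `γ`: stop if `γ ≥ η`,
re-contend if `γ < ζ`, probe the RSU if neither applies. (If `η < ζ`, the first two overlap.) -/
def ThresholdAllows (ζ η γ : ℝ) : Decision → Prop
  | Decision.halt => η ≤ γ
  | Decision.recontend => γ < ζ
  | Decision.probe => γ < η ∧ ζ ≤ γ

open Classical in
/-- The single-stage rule: stop if `γ ≥ 2^λ - 1`, re-contend otherwise. -/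
noncomputable def singleStage (lam γ : ℝ) : Decision :=
  if γ ≥ (2 : ℝ) ^ lam - 1 then Decision.halt else Decision.recontend

end Network

/-! ### The exponential integral -/

/-! Write `u = 1 + γ`; the break-even point is `u = 2 ^ λ`, where the V2V rate equals the price.
Below it, `Ŵ_i` reduces to a positive multiple of `exp (c u)` minus `λ τ₁`, which is strictly
increasing in `γ`. Above it, the advantage of probing over stopping, `Ŵ_i - τ_d (R_d - λ)`, reduces
to a positive multiple of `exp (c u) E₁(c u²)` minus `τ₁ R_d`, which is strictly decreasing for `u ≥
1`. At the break-even point both quantities equal `Ŵ_i(2 ^ λ - 1, λ)`, which is nonpositive for `i ∉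
𝒦*`. Hence probing loses to re-contending below and never beats stopping above, and strictness
places the thresholds `ζ` and `η`. The two closed forms are `What_of_le` and `What_of_ge`; the
analytic input is `exp_mul_expIntegralE1_sq_le`. The price enters only through `0 ≤ λ`, which keeps
the break-even SNR nonnegative; this is why both descriptions of the price are admissible. -/

/-- Translating by `y` fixes the domain of integration, so that integrals for different `y` compare
pointwise, and frees the factor `exp (-y)`. -/
theorem expIntegralE1_eq (y : ℝ) :
    expIntegralE1 y = Real.exp (-y) * ∫ s in Set.Ioi (0 : ℝ), Real.exp (-s) / (s + y) := by
  have h := (measurePreserving_add_right (volume : Measure ℝ) y).setIntegral_preimage_emb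
    (MeasurableEquiv.addRight y).measurableEmbedding (fun t => Real.exp (-t) / t) (Set.Ioi y)
  have hs : (fun x : ℝ => x + y) ⁻¹' Set.Ioi y = Set.Ioi 0 := by
    ext x; simp
  rw [hs] at h
  rw [expIntegralE1, ← h, ← integral_const_mul]
  congr 1
  ext s
  rw [neg_add, Real.exp_add]
  ring

theorem integrableOn_exp_neg_div_add {y : ℝ} (hy : 0 < y) :
    IntegrableOn (fun s : ℝ => Real.exp (-s) / (s + y)) (Set.Ioi 0) := by
  refine Integrable.mono' ((integrableOn_exp_neg_Ioi 0).div_const y) ?_ ?_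
  · exact (Measurable.div (by fun_prop) (by fun_prop)).aestronglyMeasurable
  · filter_upwards [ae_restrict_mem measurableSet_Ioi] with s hs
    have hs' : (0 : ℝ) < s := hs
    rw [Real.norm_of_nonneg (by positivity)]
    gcongr
    linarith

theorem expIntegralE1_pos {y : ℝ} (hy : 0 < y) : 0 < expIntegralE1 y := by
  rw [expIntegralE1_eq]
  refine mul_pos (Real.exp_pos _) ?_
  have hpos : ∀ s ∈ Set.Ioi (0 : ℝ), 0 < Real.exp (-s) / (s + y) := fun s hs => by
    have hs' : (0 : ℝ) < s := hs
    positivity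
  rw [setIntegral_pos_iff_support_of_nonneg_ae
    ((ae_restrict_mem measurableSet_Ioi).mono fun s hs => (hpos s hs).le)
    (integrableOn_exp_neg_div_add hy),
    Set.inter_eq_right.2 fun s hs => Function.mem_support.2 (hpos s hs).ne', Real.volume_Ioi]
  exact ENNReal.zero_lt_top

/-- The function `u ↦ e^{c u} E₁(c u²)` is antitone on `[1, ∞)`. -/
theorem exp_mul_expIntegralE1_sq_le {c u v : ℝ} (hc : 0 < c) (hu : 1 ≤ u) (huv : u ≤ v) :
    Real.exp (c * v) * expIntegralE1 (c * v ^ 2)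
      ≤ Real.exp (c * u) * expIntegralE1 (c * u ^ 2) := by
  have hu0 : 0 < c * u ^ 2 := by positivity
  have hle : c * u ^ 2 ≤ c * v ^ 2 := by gcongr
  rw [expIntegralE1_eq, expIntegralE1_eq, ← mul_assoc, ← mul_assoc, ← Real.exp_add,
    ← Real.exp_add]
  refine mul_le_mul (Real.exp_le_exp.2 ?_) ?_ ?_ (Real.exp_pos _).le
  -- The exponent is now `c u - c u²`; its decrease from `u` to `v` is `c (v - u) (u + v - 1)`.
  · nlinarith [mul_nonneg hc.le (mul_nonneg (sub_nonneg.2 huv)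
      (show (0 : ℝ) ≤ u + v - 1 by linarith))]
  · refine setIntegral_mono_on (integrableOn_exp_neg_div_add (hu0.trans_le hle))
      (integrableOn_exp_neg_div_add hu0) measurableSet_Ioi fun s hs => ?_
    have hs' : (0 : ℝ) < s := hs
    gcongr
  · refine setIntegral_nonneg measurableSet_Ioi fun s hs => ?_
    have hs' : (0 : ℝ) < s := hs
    have := hu0.trans_le hle
    positivity

namespace Network

variable {N : Network}

/-! ### The price is nonnegative -/

theorem τ₁_pos (N : Network) : 0 < N.τ₁ := add_pos N.τR_pos N.τC_pos

theorem τd_pos (N : Network) : 0 < N.τd := N.τ₁_pos.trans N.probe_lt_τd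

theorem τd₁_pos (N : Network) : 0 < N.τd₁ := sub_pos.2 N.probe_lt_τd

theorem relayRate_pos (N : Network) (i : Fin N.K) : 0 < N.relayRate i := by
  have h1 : 0 < ‖N.xS i - N.xR‖ := norm_pos_iff.2 (sub_ne_zero.2 (N.xS_ne_xR i))
  have h2 : 0 < ‖N.xR - N.xD i‖ := norm_pos_iff.2 (sub_ne_zero.2 (N.xR_ne_xD i))
  have := N.N0_pos
  have := N.Ps_pos
  have := N.Pr_pos
  unfold relayRate
  positivity

theorem rateV2V_nonneg {γ : ℝ} (hγ : 0 ≤ γ) : 0 ≤ rateV2V γ :=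
  Real.logb_nonneg one_lt_two (by linarith)

theorem rateV2V_lt_rateV2V {γ γ' : ℝ} (hγ : 0 ≤ γ) (h : γ < γ') : rateV2V γ < rateV2V γ' :=
  Real.logb_lt_logb one_lt_two (by linarith) (by linarith)

theorem rateV2V_two_rpow_sub_one (lam : ℝ) : rateV2V ((2 : ℝ) ^ lam - 1) = lam := by
  rw [rateV2V, add_sub_cancel, Real.logb_rpow two_pos (by norm_num)]

theorem successProb_pos (N : Network) : 0 < N.successProb := by
  have h1 := N.p₀_pos
  have h2 : 0 < 1 - N.p₀ := sub_pos.2 N.p₀_lt_one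
  have h3 : (0 : ℝ) < N.K := Nat.cast_pos.2 N.K_pos
  unfold successProb
  positivity

theorem τo_pos (N : Network) : 0 < N.τo := by
  have hs := N.successProb_pos
  have h2 : 0 < 1 - N.p₀ := sub_pos.2 N.p₀_lt_one
  have hq : (1 - N.p₀) ^ N.K ≤ 1 := pow_le_one₀ h2.le (by linarith [N.p₀_pos])
  have hτR := N.τR_pos
  have hτC := N.τC_pos
  have hδ := N.δ_pos
  -- The subtracted success probability in the collision term cancels the leading `τR`, so the sign
  -- of the collision probability is not needed.
  have heq : N.τo = N.τC + (1 - N.p₀) ^ N.K * N.δ / N.successProb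
      + (1 - (1 - N.p₀) ^ N.K) * N.τR / N.successProb := by
    unfold τo
    field_simp
    ring
  rw [heq]
  have h3 : 0 ≤ (1 - (1 - N.p₀) ^ N.K) * N.τR / N.successProb :=
    div_nonneg (mul_nonneg (sub_nonneg.2 hq) hτR.le) hs.le
  positivity

/-- The entry `0` in the maximum makes each integral nonnegative, integrable or not. -/
theorem SolvesClosedFormEquation.nonneg {lam : ℝ} (h : N.SolvesClosedFormEquation lam) :
    0 ≤ lam := by
  refine nonneg_of_mul_nonneg_left ?_ N.τo_pos
  rw [← h]
  exact mul_nonneg (by positivity) (Finset.sum_nonneg fun i _ => integral_nonneg fun x =>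
    (le_max_right _ _).trans (le_max_left _ _))

theorem ae_nonneg_expMeasure (r : ℝ) : ∀ᵐ x ∂expMeasure r, 0 ≤ x := by
  rw [ae_iff]
  have : {x : ℝ | ¬ 0 ≤ x} = Set.Iio 0 := by ext; simp
  rw [this, expMeasure, gammaMeasure, withDensity_apply _ measurableSet_Iio]
  exact lintegral_gammaPDF_of_nonpos le_rfl

theorem ae_roundLaw_V2V_nonneg (N : Network) : ∀ᵐ r ∂N.roundLaw, ∀ i, 0 ≤ r.2.1 i := by
  have h0 : ∀ i, IsProbabilityMeasure (expMeasure (N.meanV2V i)⁻¹) := fun i =>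
    isProbabilityMeasure_expMeasure (inv_pos.2 (N.meanV2V_pos i))
  have h1 : ∀ i, IsProbabilityMeasure (expMeasure (N.meanV2R i)⁻¹) := fun i =>
    isProbabilityMeasure_expMeasure (inv_pos.2 (N.meanV2R_pos i))
  have h2 : ∀ i, IsProbabilityMeasure (expMeasure (N.meanR2V i)⁻¹) := fun i =>
    isProbabilityMeasure_expMeasure (inv_pos.2 (N.meanR2V_pos i))
  refine ae_all_iff.2 fun i => ?_
  have h3 := (Measure.quasiMeasurePreserving_eval
    (fun i => expMeasure (N.meanV2V i)⁻¹) i).ae (ae_nonneg_expMeasure _)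
  exact Measure.quasiMeasurePreserving_snd.ae (Measure.quasiMeasurePreserving_fst.ae h3)

theorem ae_law_V2V_nonneg (N : Network) : ∀ᵐ ω ∂N.law, ∀ k i, 0 ≤ (ω k).2.1 i :=
  ae_all_iff.2 fun k => (measurePreserving_eval_infinitePi
    (fun _ : ℕ => N.roundLaw) k).quasiMeasurePreserving.ae N.ae_roundLaw_V2V_nonneg

theorem contentionTime_nonneg (N : Network) (r : N.RoundSample) : 0 ≤ N.contentionTime r := by
  refine add_nonneg (Finset.sum_nonneg fun j _ => ?_) N.τ₁_pos.le
  split_ifs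
  exacts [N.δ_pos.le, N.τR_pos.le]

namespace Strategy

theorem time_nonneg (s : N.Strategy) (ω : N.Sample) : 0 ≤ s.time ω := by
  refine add_nonneg (add_nonneg (Finset.sum_nonneg fun l _ => N.contentionTime_nonneg _)
    (Finset.sum_nonneg fun l _ => ?_)) N.τd_pos.le
  split_ifs
  exacts [N.τ₁_pos.le, le_rfl]

theorem ae_reward_nonneg (s : N.Strategy) : ∀ᵐ ω ∂N.law, 0 ≤ s.reward ω := by
  filter_upwards [N.ae_law_V2V_nonneg] with ω hω
  have h : 0 ≤ rateV2V (N.firstObs (ω (s.stopRound ω))).2.2 := rateV2V_nonneg (hω _ _)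
  unfold reward
  dsimp only
  split_ifs
  · exact mul_nonneg N.τd_pos.le h
  -- The maximum dominates the V2V rate, so the sign of the RSU rate is irrelevant.
  · exact mul_nonneg N.τd₁_pos.le (h.trans (le_max_left _ _))

theorem throughput_nonneg (s : N.Strategy) : 0 ≤ s.throughput :=
  div_nonneg (integral_nonneg_of_ae s.ae_reward_nonneg) (integral_nonneg s.time_nonneg)

end Strategy

theorem IsMaxThroughput.nonneg {lam : ℝ} (h : N.IsMaxThroughput lam) : 0 ≤ lam := by
  -- As `ℝ` has no least element, the empty set has no supremum; no feasible strategy need be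
  -- constructed.
  obtain ⟨x, s, hs, rfl⟩ := h.nonempty
  exact s.throughput_nonneg.trans (h.1 ⟨s, hs, rfl⟩)

/-! ### The decision function on both sides of `2 ^ λ - 1` -/

theorem four_rpow_eq_sq (lam : ℝ) : (4 : ℝ) ^ lam = ((2 : ℝ) ^ lam) ^ 2 := by
  rw [sq, ← Real.mul_rpow two_pos.le two_pos.le]
  norm_num

/-- Below the threshold `2 ^ λ - 1`, the indicator in `Ŵ_i` vanishes and `Ω = 4 ^ λ - 1`. -/
theorem What_of_le (i : Fin N.K) {γ lam : ℝ} (hγ : 0 ≤ γ) (h : γ ≤ (2 : ℝ) ^ lam - 1) :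
    N.What i γ lam = N.τd₁ / (2 * Real.log 2) *
      (Real.exp (N.relayRate i * (1 + γ)) *
        expIntegralE1 (N.relayRate i * ((2 : ℝ) ^ lam) ^ 2)) - lam * N.τ₁ := by
  have hmax : max ((4 : ℝ) ^ lam - 1) (γ ^ 2 + 2 * γ) = ((2 : ℝ) ^ lam) ^ 2 - 1 := by
    rw [four_rpow_eq_sq]
    exact max_eq_left (by nlinarith)
  have hR : ¬ rateV2V γ > lam := by
    rw [gt_iff_lt, not_lt, rateV2V, Real.logb_le_iff_le_rpow one_lt_two (by linarith)]
    linarith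
  -- With this value the logarithmic term cancels the exponential part of `λ F_r`, leaving `λ
  -- τ_{d,1} - λ τ_d = -λ τ₁`.
  have hlog : Real.log (((2 : ℝ) ^ lam) ^ 2) = 2 * lam * Real.log 2 := by
    rw [Real.log_pow, Real.log_rpow two_pos]
    push_cast
    ring
  have hl2 : Real.log 2 ≠ 0 := (Real.log_pos one_lt_two).ne'
  unfold What relayCDF
  simp only [hmax, if_neg hR, sub_add_cancel, hlog]
  unfold τd₁
  field_simp
  ring

/-- Above the threshold `2 ^ λ - 1`, we have `Ω = γ ^ 2 + 2 * γ`. -/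
theorem What_of_ge (i : Fin N.K) {γ lam : ℝ} (hγ : 0 ≤ γ) (h : (2 : ℝ) ^ lam - 1 ≤ γ) :
    N.What i γ lam = N.τd * (rateV2V γ - lam) + (N.τd₁ / (2 * Real.log 2) *
      (Real.exp (N.relayRate i * (1 + γ)) * expIntegralE1 (N.relayRate i * (1 + γ) ^ 2))
        - N.τ₁ * rateV2V γ) := by
  have h2 : (0 : ℝ) < 2 ^ lam := Real.rpow_pos_of_pos two_pos _
  have hmax : max ((4 : ℝ) ^ lam - 1) (γ ^ 2 + 2 * γ) = (1 + γ) ^ 2 - 1 := by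
    rw [four_rpow_eq_sq, max_eq_right (by nlinarith)]
    ring
  have hR : lam ≤ rateV2V γ := by
    rw [rateV2V, Real.le_logb_iff_rpow_le one_lt_two (by linarith)]
    linarith
  -- The indicator can be dropped: at equality its factor vanishes.
  have hite : (if rateV2V γ > lam then (rateV2V γ - lam) * N.relayCDF i (γ ^ 2 + γ) else 0)
      = (rateV2V γ - lam) * N.relayCDF i (γ ^ 2 + γ) := by
    split_ifs with h'
    · rfl
    · rw [le_antisymm (not_lt.1 h') hR, sub_self, zero_mul]
  have hl2 : Real.log 2 ≠ 0 := (Real.log_pos one_lt_two).ne'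
  have hlog : Real.log ((1 + γ) ^ 2) = 2 * rateV2V γ * Real.log 2 := by
    rw [Real.log_pow, rateV2V, Real.logb]
    field_simp
    push_cast
    ring
  have hsub : (1 + γ) ^ 2 - 1 - γ = γ ^ 2 + γ := by ring
  unfold What
  simp only [hmax, hite, sub_add_cancel, hlog, hsub]
  unfold τd₁ relayCDF
  field_simp
  ring

/-- Only `exp (c (1 + γ))` depends on `γ`, and its coefficient is positive. -/
theorem What_strictMonoOn_below (i : Fin N.K) {γ γ' lam : ℝ} (hγ : 0 ≤ γ) (h : γ < γ')
    (h' : γ' ≤ (2 : ℝ) ^ lam - 1) : N.What i γ lam < N.What i γ' lam := by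
  rw [What_of_le i hγ (h.le.trans h'), What_of_le i (hγ.trans h.le) h']
  have hc := N.relayRate_pos i
  have hE := expIntegralE1_pos (y := N.relayRate i * ((2 : ℝ) ^ lam) ^ 2) (by positivity)
  have hτ := N.τd₁_pos
  have hl2 : 0 < Real.log 2 := Real.log_pos one_lt_two
  gcongr

/-- Above the threshold `2 ^ λ - 1`, the advantage of probing over stopping decreases. -/
theorem What_sub_strictAntiOn_above (i : Fin N.K) {γ γ' lam : ℝ} (hγ : 0 ≤ γ) (h : γ < γ')
    (h' : (2 : ℝ) ^ lam - 1 ≤ γ) :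
    N.What i γ' lam - N.τd * (rateV2V γ' - lam) < N.What i γ lam - N.τd * (rateV2V γ - lam) := by
  rw [What_of_ge i hγ h', What_of_ge i (hγ.trans h.le) (h'.trans h.le), add_sub_cancel_left,
    add_sub_cancel_left]
  have hτ := N.τd₁_pos
  have hl2 : 0 < Real.log 2 := Real.log_pos one_lt_two
  -- Strictness comes from the rate term; the exponential-integral term need only be antitone.
  refine (sub_lt_sub_left (mul_lt_mul_of_pos_left (rateV2V_lt_rateV2V hγ h) N.τ₁_pos) _).trans_le
    (sub_le_sub_right (mul_le_mul_of_nonneg_left ?_ (by positivity)) _)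
  exact exp_mul_expIntegralE1_sq_le (N.relayRate_pos i) (by linarith) (by linarith)

theorem two_rpow_sub_one_nonneg {lam : ℝ} (h0 : 0 ≤ lam) : 0 ≤ (2 : ℝ) ^ lam - 1 :=
  sub_nonneg.2 (Real.one_le_rpow one_le_two h0)

/-! ### Pairs that gain nothing from probing at the break-even SNR -/

section NotMemKStar

variable {lam : ℝ} {i : Fin N.K} {γ : ℝ}

theorem What_threshold_nonpos (hi : i ∉ N.KStar lam) :
    N.What i ((2 : ℝ) ^ lam - 1) lam ≤ 0 := not_lt.1 hi

theorem What_neg_of_lt (hi : i ∉ N.KStar lam) (hγ : 0 ≤ γ) (h : γ < (2 : ℝ) ^ lam - 1) :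
    N.What i γ lam < 0 :=
  (What_strictMonoOn_below i hγ h le_rfl).trans_le (What_threshold_nonpos hi)

theorem What_lt_of_gt (h0 : 0 ≤ lam) (hi : i ∉ N.KStar lam) (h : (2 : ℝ) ^ lam - 1 < γ) :
    N.What i γ lam < N.τd * (rateV2V γ - lam) := by
  have h1 := What_sub_strictAntiOn_above i (two_rpow_sub_one_nonneg h0) h le_rfl
  rw [rateV2V_two_rpow_sub_one, sub_self, mul_zero, sub_zero] at h1
  linarith [What_threshold_nonpos hi]

theorem What_le_of_ge (h0 : 0 ≤ lam) (hi : i ∉ N.KStar lam) (h : (2 : ℝ) ^ lam - 1 ≤ γ) :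
    N.What i γ lam ≤ N.τd * (rateV2V γ - lam) := by
  rcases h.eq_or_lt with rfl | h
  · rw [rateV2V_two_rpow_sub_one, sub_self, mul_zero]
    exact What_threshold_nonpos hi
  · exact (What_lt_of_gt h0 hi h).le

end NotMemKStar

theorem le_rateV2V_iff {lam γ : ℝ} (hγ : 0 ≤ γ) :
    lam ≤ rateV2V γ ↔ (2 : ℝ) ^ lam - 1 ≤ γ := by
  rw [rateV2V, Real.le_logb_iff_rpow_le one_lt_two (by linarith), sub_le_iff_le_add, add_comm]

end Network

theorem corollary1 (N : Network) (lam : ℝ)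
    (hlam : N.IsMaxThroughput lam ∨ N.SolvesClosedFormEquation lam)
    (i : Fin N.K) (hi : i ∉ N.KStar lam) :
    (∀ γ : ℝ, 0 ≤ γ →
      N.What i γ lam ≤ max ((Real.logb 2 (1 + γ) - lam) * N.τd) 0) ∧
    (∀ (k : ℕ) (h : Fin k → N.Record) (t γ : ℝ), 0 ≤ γ →
      (N.hatStrategy lam).first k h (i, t, γ) =
        if γ ≥ (2 : ℝ) ^ lam - 1 then Decision.halt else Decision.recontend) ∧
    (∀ ζ η : ℝ, N.IsZeta i lam ζ → N.IsEta i lam η →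
      η ≤ (2 : ℝ) ^ lam - 1 ∧ (2 : ℝ) ^ lam - 1 ≤ ζ ∧
      ∀ γ : ℝ, 0 ≤ γ →
        ¬ Network.ThresholdAllows ζ η γ Decision.probe ∧
        Network.ThresholdAllows ζ η γ (Network.singleStage lam γ)) := by
  have h0 : 0 ≤ lam := hlam.elim (·.nonneg) (·.nonneg)
  have hτ := N.τd_pos
  refine ⟨fun γ hγ => ?_, fun k h t γ hγ => ?_, fun ζ η hζ hη => ?_⟩
  · rcases lt_or_ge γ ((2 : ℝ) ^ lam - 1) with hlt | hge
    · exact (Network.What_neg_of_lt hi hγ hlt).le.trans (le_max_right _ _)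
    · rw [mul_comm]
      exact (Network.What_le_of_ge h0 hi hge).trans (le_max_left _ _)
  · have hrate := Network.le_rateV2V_iff (lam := lam) hγ
    dsimp only [Network.hatStrategy]
    rw [mul_comm lam, ← mul_sub]
    rcases lt_or_ge γ ((2 : ℝ) ^ lam - 1) with hlt | hge
    · have hneg : N.τd * (Network.rateV2V γ - lam) < 0 :=
        mul_neg_of_pos_of_neg hτ (sub_neg.2 (not_le.1 fun hle => hlt.not_ge (hrate.1 hle)))
      rw [if_neg (not_le.2 (hneg.trans_le (le_max_right _ _))),
        if_pos ⟨hneg, Network.What_neg_of_lt hi hγ hlt⟩, if_neg hlt.not_ge]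
    · rw [if_pos (max_le (Network.What_le_of_ge h0 hi hge)
        (mul_nonneg hτ.le (sub_nonneg.2 (hrate.2 hge)))), if_pos hge]
  · have hηle : η ≤ (2 : ℝ) ^ lam - 1 :=
      -- Beyond the break-even point the strict inequality excludes the equation defining `η`; below
      -- it, `ζ` is excluded likewise.
      not_lt.1 fun hlt => (Network.What_lt_of_gt h0 hi hlt).ne hη.2
    have hleζ : (2 : ℝ) ^ lam - 1 ≤ ζ :=
      not_lt.1 fun hlt => (Network.What_neg_of_lt hi hζ.1 hlt).ne hζ.2
    refine ⟨hηle, hleζ, fun γ _ => ⟨fun hp => ?_, ?_⟩⟩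
    · exact absurd (hp.1.trans_le (hηle.trans (hleζ.trans hp.2))) (lt_irrefl γ)
    · unfold Network.singleStage
      split_ifs with hge
      · exact hηle.trans hge
      · exact (not_le.1 hge).trans_le hleζ
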